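/- Let $r,q\ge 0$ and $\bar d=(d_0,\dots,d_q)\in\mathbb N^{q+1}$. For an integer $e$ let $S_e$ be the space of homogeneous polynomials of degree $e$ in $\mathbb C[x_0,\dots,x_r]$, with $S_e=0$ for $e<0$. Let $R=\sum_i x_i\,\partial/\partial x_i$ be the radial vector field on $\mathbb C^{r+1}$ and $i_R$ the interior product with $R$. The singular set $\operatorname{sing}(\Theta)$ of a polynomial differential form $\Theta$ on $\mathbb C^{r+1}$ is the set of points of $\mathbb C^{r+1}$ at which $\Theta$ vanishes; the empty set has codimension $\infty$. A polynomial $f\in\mathbb C[y_0,\dots,y_q]$ is weighted homogeneous of type $\bar d$ and degree $e$ if it is a linear combination of monomials $y^\alpha$ with $\sum_k d_k\alpha_k=e$. Let $\mathrm{GL}(q,\bar d)$ be the set (it is a group under composition) of polynomial maps $f=(f_0,\dots,f_q):\mathbb C^{q+1}\to\mathbb C^{q+1}$ such that each $f_j$ is weighted homogeneous of type $\bar d$ and degree $d_j$, and the derivative $df(0)$ is invertible. Let $F=(F_0,\dots,F_q)\in S_{d_0}\times\dots\times S_{d_q}$ be such that $dF_0\wedge\dots\wedge dF_q\ne 0$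 and $\operatorname{codim}\operatorname{sing}(dF_0\wedge\dots\wedge dF_q)\ge 2$. (1) Let $G=(G_0,\dots,G_q)\in S_{d_0}\times\dots\times S_{d_q}$ be such that $dG_0\wedge\dots\wedge dG_q\neq 0$. Then the following conditions are equivalent: (a) $i_R(dG_0\wedge\dots\wedge dG_q)=c\, i_R(dF_0\wedge\dots\wedge dF_q)$ for some $c\in\mathbb C^*$; (b) $dG_0\wedge\dots\wedge dG_q=c\, dF_0\wedge\dots\wedge dF_q$ for some $c\in\mathbb C^*$; (c) there are $A_{jk}\in S_{d_j-d_k}$ such that $dG_j=\sum_{k=0}^q A_{jk}\,dF_k$ for all $j$; (d) there are $f_0,\dots,f_q\in\mathbb C[y_0,\dots,y_q]$ such that $G_j=f_j(F_0,\dots,F_q)$ for all $j$; (e) there are $f_0,\dots,f_q\in\mathbb C[y_0,\dots,y_q]$, with $f_j$ weighted homogeneous of type $\bar d$ and degree $d_j$, such that $G_j=f_j(F_0,\dots,F_q)$ for all $j$; each $f_j$ is the only polynomial with $G_j=f_j(F_0,\dots,F_q)$; and $(f_0,\dots,f_q)\in\mathrm{GL}(q,\bar d)$. (2) Let $\mu(G)=i_R(dG_0\wedge\dots\wedge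 dG_q)$ for $G\in S_{d_0}\times\dots\times S_{d_q}$. The map $f\mapsto (f_0(F),\dots,f_q(F))$ is a bijection from $\mathrm{GL}(q,\bar d)$ onto the fiber through $F$ of the map to projective space induced by $\mu$, that is, onto $\{G\in S_{d_0}\times\dots\times S_{d_q} : \mu(G)=c\,\mu(F)\text{ for some }c\in\mathbb C^*\}$. -/

import Mathlib

open scoped KaehlerDifferential

noncomputable section

/-- The ring `ℂ[x_0, …, x_r]` of polynomial functions on `ℂ^{r+1}`. -/
abbrev PolyRing (r : ℕ) : Type := MvPolynomial (Fin (r + 1)) ℂ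

/-- Polynomial differential forms on `ℂ^{r+1}`: the exterior algebra, over `ℂ[x_0, …, x_r]`, of the
(free, with basis `dx_0, …, dx_r`) module of polynomial `1`-forms. -/
abbrev PolyForm (r : ℕ) : Type := ExteriorAlgebra (PolyRing r) (Ω[PolyRing r⁄ℂ])

/-- The form `dF_0 ∧ ⋯ ∧ dF_q`. -/
def wedgeD {r q : ℕ} (F : Fin (q + 1) → PolyRing r) : PolyForm r :=
  ExteriorAlgebra.ιMulti (PolyRing r) (q + 1) fun j => KaehlerDifferential.D ℂ (PolyRing r) (F j)

/-- The radial (Euler) vector field `R = ∑ x_i ∂/∂x_i`, as a derivation of `ℂ[x_0, …, x_r]`. -/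
def eulerField (r : ℕ) : Derivation ℂ (PolyRing r) (PolyRing r) :=
  MvPolynomial.mkDerivation ℂ fun i => MvPolynomial.X i

/-- The interior product `i_R ω` with the radial vector field `R`: the antiderivation of degree `-1`
of the algebra of forms that sends `dF` to `R(F)`. -/
def contractEuler {r : ℕ} (ω : PolyForm r) : PolyForm r :=
  CliffordAlgebra.contractLeft (Q := (0 : QuadraticForm (PolyRing r) (Ω[PolyRing r⁄ℂ])))
    (eulerField r).liftKaehlerDifferential ω

/-- The singular set of a form `ω`: the points `x` of `ℂ^{r+1}` at which `ω` vanishes, that is, at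
which the class of `ω` in the fiber `M / 𝔪_x M` of the free module `M` of forms is zero, where
`𝔪_x` is the ideal of the polynomials that vanish at `x`. -/
def singSet {r : ℕ} (ω : PolyForm r) : Set (Fin (r + 1) → ℂ) :=
  {x | ω ∈ RingHom.ker (MvPolynomial.eval x : PolyRing r →+* ℂ) • (⊤ : Submodule (PolyRing r) (PolyForm r))}

/-- The codimension in `ℂ^{r+1}` of an algebraic subset `Z`: the height of its ideal, i.e. the least
codimension of an irreducible component of `Z` (and `⊤` if `Z` is empty). -/
def algCodim {r : ℕ} (Z : Set (Fin (r + 1) → ℂ)) : ℕ∞ :=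
  (MvPolynomial.vanishingIdeal ℂ Z).height

/-- `p ∈ S_e` for an integer `e`: every monomial of `p` has degree `e`. For `e < 0` this says
`p = 0`. -/
def IsHomogeneousInt {r : ℕ} (p : PolyRing r) (e : ℤ) : Prop :=
  ∀ m ∈ p.support, (m.degree : ℤ) = e

/-- The Jacobian matrix `df(0)` at the origin of a polynomial map `f : ℂ^{q+1} → ℂ^{q+1}`. -/
def jacobianAtZero {q : ℕ} (f : Fin (q + 1) → MvPolynomial (Fin (q + 1)) ℂ) :
    Matrix (Fin (q + 1)) (Fin (q + 1)) ℂ :=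
  Matrix.of fun i k => MvPolynomial.eval 0 (MvPolynomial.pderiv k (f i))

/-- `GL(q, d̄)`: the polynomial maps `f = (f_0, …, f_q)` of type `d̄` (each `f_i` is weighted
homogeneous of degree `d_i`, the variable `y_k` having weight `d_k`) with `df(0)` invertible. -/
def weightedGL {q : ℕ} (d : Fin (q + 1) → ℕ) : Set (Fin (q + 1) → MvPolynomial (Fin (q + 1)) ℂ) :=
  {f | (∀ i, MvPolynomial.IsWeightedHomogeneous d (f i) (d i)) ∧ IsUnit (jacobianAtZero f)}

end

/-!
The differentials of `F` are handled through the Jacobian matrix and its maximal minors, which carry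
the same information as the form `dF_0 ∧ ⋯ ∧ dF_q` (`wedgeD_eq_smul_iff`).

Contracting with the radial field loses nothing: by Cartan's formula
`d (i_R dF_0 ∧ ⋯ ∧ dF_q) = (d_0 + ⋯ + d_q) dF_0 ∧ ⋯ ∧ dF_q`, and the degrees are positive since the
`dF_j` are nonzero (`wedgeD_eq_smul_of_contractEuler`). The exterior derivative needed here is built
in coordinates, on `ℂ[x] ⊗ Λ(ℂ^{r+1})`.

If `dG_0 ∧ ⋯ ∧ dG_q` is a multiple of `dF_0 ∧ ⋯ ∧ dF_q`, then by Cramer's rule the Jacobian matrices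
have the same row span over the field of fractions. That the singular set has codimension at least
two means that the minors of the Jacobian of `F` have no common prime factor (a common factor `p`
would put the hypersurface `p = 0` in the singular set), so the coefficients of the `dG_j` in
terms of the `dF_k` have trivial denominator: this is `exists_eq_vecMul_of_minors`.

The central step is that a homogeneous `g` with `dg = ∑ a_k dF_k` is a polynomial in the `F_k`
(`exists_eq_aeval_of_gradient`). Differentiating gives `∑ da_k ∧ dF_k = 0`, so that
`da_k ∧ dF_0 ∧ ⋯ ∧ dF_q = 0`, and by the same division property the `da_k` are combinations of the
`dF_l`. As `a_k` has smaller degree than `g`, induction makes it a polynomial in the `F_k`, and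
Euler's identity `deg(g) g = ∑ d_k a_k F_k` concludes.

Uniqueness of the polynomials `f_j` is the algebraic independence of the `F_k`
(`aeval_injective_of_wedgeD_ne_zero`). Finally, for `G = f(F)` the factor between the two wedge
products is the determinant of `(∂f_j/∂y_k)(F)`, which is constant for degree reasons and equals
`det df(0)` because `F` vanishes at the origin (`wedgeD_aeval`); this identifies the condition
`f ∈ GL(q, d̄)` with the nonvanishing of `dG_0 ∧ ⋯ ∧ dG_q`.
-/

noncomputable section

open scoped TensorProduct

/-! ### Wedge products of differentials and Jacobian minors -/

/-- The Jacobian matrix `(∂F_j/∂x_i)`. -/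
def jacobian {r q : ℕ} (F : Fin (q + 1) → PolyRing r) :
    Matrix (Fin (q + 1)) (Fin (r + 1)) (PolyRing r) :=
  Matrix.of fun j i => MvPolynomial.pderiv i (F j)

/-- The determinant of the columns `I 0, …, I q` of the Jacobian matrix of `F`; the column selection
`I` is arbitrary, not required to be increasing or injective. -/
def jacobianMinor {r q : ℕ} (F : Fin (q + 1) → PolyRing r) (I : Fin (q + 1) → Fin (r + 1)) :
    PolyRing r :=
  ((jacobian F).submatrix id I).det

lemma D_eq_sum_pderiv {r : ℕ} (f : PolyRing r) :
    KaehlerDifferential.D ℂ (PolyRing r) f =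
      ∑ i, MvPolynomial.pderiv i f • KaehlerDifferential.D ℂ (PolyRing r) (MvPolynomial.X i) := by
  have h := (KaehlerDifferential.mvPolynomialBasis ℂ (Fin (r + 1))).sum_repr
    (KaehlerDifferential.D ℂ (PolyRing r) f)
  simpa only [KaehlerDifferential.mvPolynomialBasis_repr_apply,
    KaehlerDifferential.mvPolynomialBasis_apply] using h.symm

lemma D_eq_sum_smul_D_iff {r q : ℕ} (F : Fin (q + 1) → PolyRing r) (g : PolyRing r)
    (a : Fin (q + 1) → PolyRing r) :
    KaehlerDifferential.D ℂ (PolyRing r) g =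
        ∑ k, a k • KaehlerDifferential.D ℂ (PolyRing r) (F k) ↔
      (fun i => MvPolynomial.pderiv i g) = Matrix.vecMul a (jacobian F) := by
  rw [← (KaehlerDifferential.mvPolynomialBasis ℂ (Fin (r + 1))).repr.injective.eq_iff,
    DFunLike.ext_iff, funext_iff]
  refine forall_congr' fun i => ?_
  rw [KaehlerDifferential.mvPolynomialBasis_repr_apply, map_sum, Finsupp.finsetSum_apply]
  simp only [map_smul, Finsupp.smul_apply, KaehlerDifferential.mvPolynomialBasis_repr_apply,
    Matrix.vecMul, dotProduct, jacobian, Matrix.of_apply, smul_eq_mul]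

/-- The functional on forms that reads off the component along `dx_{I 0} ∧ ⋯ ∧ dx_{I q}`. -/
def formCoeff {r q : ℕ} (I : Fin (q + 1) → Fin (r + 1)) : PolyForm r →ₗ[PolyRing r] PolyRing r :=
  ExteriorAlgebra.liftAlternating (Pi.single (q + 1)
    (Matrix.detRowAlternating.compLinearMap (LinearMap.pi fun a =>
      Finsupp.lapply (I a) ∘ₗ
        (KaehlerDifferential.mvPolynomialBasis ℂ (Fin (r + 1))).repr.toLinearMap)))

lemma formCoeff_wedgeD {r q : ℕ} (I : Fin (q + 1) → Fin (r + 1)) (F : Fin (q + 1) → PolyRing r) :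
    formCoeff I (wedgeD F) = jacobianMinor F I := by
  rw [formCoeff, wedgeD, ExteriorAlgebra.liftAlternating_apply_ιMulti, Pi.single_eq_same]
  rw [AlternatingMap.compLinearMap_apply]
  change Matrix.det _ = _
  rw [jacobianMinor]
  congr 1
  ext j a
  simp [jacobian, KaehlerDifferential.mvPolynomialBasis_repr_apply]

/-- A form `dF_0 ∧ ⋯ ∧ dF_q` is recovered from the minors of the Jacobian. Summing over all `I`
rather than the increasing ones costs the factor `(q + 1)!`, harmless over `ℂ`. -/
lemma factorial_smul_wedgeD {r q : ℕ} (F : Fin (q + 1) → PolyRing r) :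
    (Nat.factorial (q + 1)) • wedgeD F =
      ∑ I : Fin (q + 1) → Fin (r + 1), jacobianMinor F I • wedgeD (fun a => MvPolynomial.X (I a)) := by
  have expand : ∀ σ : Equiv.Perm (Fin (q + 1)), wedgeD F = ∑ I : Fin (q + 1) → Fin (r + 1),
      (Equiv.Perm.sign σ • ∏ a, MvPolynomial.pderiv (I a) (F (σ a))) •
        wedgeD (fun a => MvPolynomial.X (I a)) := by
    intro σ
    have h1 : wedgeD F = Equiv.Perm.sign σ • wedgeD (F ∘ σ) := by
      rw [wedgeD, wedgeD]
      have := (ExteriorAlgebra.ιMulti (PolyRing r) (q + 1)).map_perm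
        (fun j => KaehlerDifferential.D ℂ (PolyRing r) (F j)) σ
      simp only [Function.comp_apply, Function.comp_def] at this ⊢
      rw [this, smul_smul, Int.units_mul_self, one_smul]
    have h2 : wedgeD (F ∘ σ) = ∑ I : Fin (q + 1) → Fin (r + 1),
        (∏ a, MvPolynomial.pderiv (I a) (F (σ a))) • wedgeD (fun a => MvPolynomial.X (I a)) := by
      rw [wedgeD]
      simp only [Function.comp_apply]
      rw [show (fun j => KaehlerDifferential.D ℂ (PolyRing r) (F (σ j))) = fun j =>
        ∑ i, MvPolynomial.pderiv i (F (σ j)) •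
          KaehlerDifferential.D ℂ (PolyRing r) (MvPolynomial.X i) from
        funext fun j => D_eq_sum_pderiv _]
      rw [← AlternatingMap.coe_multilinearMap, MultilinearMap.map_sum]
      refine Finset.sum_congr rfl fun I _ => ?_
      rw [MultilinearMap.map_smul_univ]
      rfl
    rw [h1, h2, Finset.smul_sum]
    refine Finset.sum_congr rfl fun I _ => ?_
    rw [smul_assoc]
  calc (Nat.factorial (q + 1)) • wedgeD F
      = ∑ σ : Equiv.Perm (Fin (q + 1)), wedgeD F := by
        rw [Finset.sum_const, Finset.card_univ, Fintype.card_perm, Fintype.card_fin]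
    _ = _ := by
        rw [Finset.sum_congr rfl fun σ _ => expand σ, Finset.sum_comm]
        refine Finset.sum_congr rfl fun I _ => ?_
        rw [← Finset.sum_smul, jacobianMinor, Matrix.det_apply]
        simp [jacobian]

lemma wedgeD_eq_smul_iff {r q : ℕ} (F G : Fin (q + 1) → PolyRing r) (c : ℂ) :
    wedgeD G = c • wedgeD F ↔ ∀ I, jacobianMinor G I = c • jacobianMinor F I := by
  constructor
  · intro h I
    rw [← formCoeff_wedgeD, ← formCoeff_wedgeD, h, LinearMap.map_smul_of_tower]
  · intro h
    have hne : ((Nat.factorial (q + 1) : ℕ) : ℂ) ≠ 0 := by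
      exact_mod_cast Nat.factorial_ne_zero _
    apply smul_right_injective _ hne
    simp only [Nat.cast_smul_eq_nsmul]
    rw [smul_comm, factorial_smul_wedgeD, factorial_smul_wedgeD, Finset.smul_sum]
    refine Finset.sum_congr rfl fun I _ => ?_
    rw [h, smul_assoc]

lemma wedgeD_ne_zero_iff {r q : ℕ} (F : Fin (q + 1) → PolyRing r) :
    wedgeD F ≠ 0 ↔ ∃ I, jacobianMinor F I ≠ 0 := by
  have := wedgeD_eq_smul_iff F F 0
  simp only [zero_smul] at this
  rw [Ne, this, not_forall]

lemma mem_singSet_of_forall_eval {r q : ℕ} (F : Fin (q + 1) → PolyRing r)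
    (x : Fin (r + 1) → ℂ) (h : ∀ I, MvPolynomial.eval x (jacobianMinor F I) = 0) :
    x ∈ singSet (wedgeD F) := by
  have hne : ((Nat.factorial (q + 1) : ℕ) : ℂ) ≠ 0 := by
    exact_mod_cast Nat.factorial_ne_zero _
  have hw : wedgeD F = ((Nat.factorial (q + 1) : ℕ) : ℂ)⁻¹ •
      ∑ I : Fin (q + 1) → Fin (r + 1),
        jacobianMinor F I • wedgeD (fun a => MvPolynomial.X (I a)) := by
    rw [← factorial_smul_wedgeD, ← Nat.cast_smul_eq_nsmul ℂ, smul_smul, inv_mul_cancel₀ hne,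
      one_smul]

  rw [singSet, Set.mem_ofPred_eq, hw, ← algebraMap_smul (PolyRing r)]
  refine Submodule.smul_mem _ _ (Submodule.sum_mem _ fun I _ => ?_)
  exact Submodule.smul_mem_smul (h I) Submodule.mem_top

/-! ### The exterior derivative and Cartan's formula -/

lemma pderiv_pderiv_comm {r : ℕ} (i j : Fin (r + 1)) (f : PolyRing r) :
    MvPolynomial.pderiv i (MvPolynomial.pderiv j f) =
      MvPolynomial.pderiv j (MvPolynomial.pderiv i f) := by
  have h : ⁅(MvPolynomial.pderiv i : Derivation ℂ (PolyRing r) (PolyRing r)),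
      (MvPolynomial.pderiv j : Derivation ℂ (PolyRing r) (PolyRing r))⁆ = 0 := by
    apply MvPolynomial.derivation_ext
    intro k
    rw [Derivation.commutator_apply, MvPolynomial.pderiv_X, MvPolynomial.pderiv_X]
    simp [Pi.single_apply, apply_ite]
  have := Derivation.congr_fun h f
  rwa [Derivation.commutator_apply, Derivation.zero_apply, sub_eq_zero] at this

/-- The algebra `ℂ[x_0, …, x_r] ⊗ Λ(ℂ^{r+1})` of forms written in coordinates; the partial
derivatives of the coefficients, hence the exterior derivative, are defined on it at once. -/
abbrev CoordForm (r : ℕ) : Type :=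
  PolyRing r ⊗[ℂ] ExteriorAlgebra ℂ (Fin (r + 1) → ℂ)

/-- The coordinate form `dx_i`. -/
def coordDX {r : ℕ} (i : Fin (r + 1)) : CoordForm r :=
  1 ⊗ₜ ExteriorAlgebra.ι ℂ (Pi.single i 1)

lemma coordDX_mul_swap {r : ℕ} (i j : Fin (r + 1)) :
    (coordDX i : CoordForm r) * coordDX j = -(coordDX j * coordDX i) := by
  rw [coordDX, coordDX, Algebra.TensorProduct.tmul_mul_tmul, Algebra.TensorProduct.tmul_mul_tmul,
    ← TensorProduct.tmul_neg, mul_one, eq_neg_of_add_eq_zero_left (ExteriorAlgebra.ι_add_mul_swap _ _)]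

lemma sum_symm_smul_coordDX {r : ℕ} (c : Fin (r + 1) → Fin (r + 1) → PolyRing r)
    (hc : ∀ i j, c i j = c j i) :
    ∑ i, ∑ j, c i j • ((coordDX i : CoordForm r) * coordDX j) = 0 := by
  have h : ∑ i, ∑ j, c i j • ((coordDX i : CoordForm r) * coordDX j) =
      -∑ i, ∑ j, c i j • ((coordDX i : CoordForm r) * coordDX j) := by
    conv_lhs => rw [Finset.sum_comm]
    simp only [← Finset.sum_neg_distrib]
    refine Finset.sum_congr rfl fun i _ => Finset.sum_congr rfl fun j _ => ?_
    rw [hc j i, coordDX_mul_swap j i, smul_neg]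
  have h2 : (2 : ℂ) • ∑ i, ∑ j, c i j • ((coordDX i : CoordForm r) * coordDX j) = 0 := by
    rw [two_smul]
    nth_rewrite 1 [h]
    exact neg_add_cancel _
  exact (smul_eq_zero_iff_right two_ne_zero).1 h2

/-- A `1`-form in coordinates. -/
def coordOneForm (r : ℕ) : Ω[PolyRing r⁄ℂ] →ₗ[PolyRing r] CoordForm r :=
  (KaehlerDifferential.mvPolynomialBasis ℂ (Fin (r + 1))).constr (PolyRing r) coordDX

lemma coordOneForm_apply {r : ℕ} (m : Ω[PolyRing r⁄ℂ]) : coordOneForm r m =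
    ∑ i, (KaehlerDifferential.mvPolynomialBasis ℂ (Fin (r + 1))).repr m i • coordDX i := by
  rw [coordOneForm, Module.Basis.constr_apply_fintype]
  rfl

lemma coordOneForm_D {r : ℕ} (f : PolyRing r) :
    coordOneForm r (KaehlerDifferential.D ℂ (PolyRing r) f) =
      ∑ i, MvPolynomial.pderiv i f • coordDX i := by
  rw [coordOneForm_apply]
  simp only [KaehlerDifferential.mvPolynomialBasis_repr_apply]

lemma coordOneForm_mul_self {r : ℕ} (m : Ω[PolyRing r⁄ℂ]) :
    coordOneForm r m * coordOneForm r m = 0 := by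
  rw [coordOneForm_apply, Finset.sum_mul_sum]
  simp only [smul_mul_smul_comm]
  exact sum_symm_smul_coordDX _ fun i j => mul_comm _ _

/-- Writing a form in coordinates. -/
def toCoord (r : ℕ) : PolyForm r →ₐ[PolyRing r] CoordForm r :=
  ExteriorAlgebra.lift (PolyRing r) ⟨coordOneForm r, coordOneForm_mul_self⟩

lemma toCoord_ι {r : ℕ} (m : Ω[PolyRing r⁄ℂ]) :
    toCoord r (ExteriorAlgebra.ι (PolyRing r) m) = coordOneForm r m := by
  rw [toCoord, ExteriorAlgebra.lift_ι_apply]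

lemma toCoord_injective (r : ℕ) : Function.Injective (toCoord r) := by
  let v : (Fin (r + 1) → ℂ) →ₗ[ℂ] PolyForm r := Fintype.linearCombination ℂ fun i =>
    ExteriorAlgebra.ι (PolyRing r) (KaehlerDifferential.D ℂ (PolyRing r) (MvPolynomial.X i))
  have hv : ∀ m, v m * v m = 0 := by
    intro m
    have : v m = ExteriorAlgebra.ι (PolyRing r)
        (∑ i, m i • KaehlerDifferential.D ℂ (PolyRing r) (MvPolynomial.X i)) := by
      rw [Fintype.linearCombination_apply, map_sum]
      refine Finset.sum_congr rfl fun i _ => ?_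
      rw [LinearMap.map_smul_of_tower]
    rw [this, ExteriorAlgebra.ι_sq_zero]
  let back : CoordForm r →ₐ[PolyRing r] PolyForm r :=
    Algebra.TensorProduct.lift (Algebra.ofId (PolyRing r) (PolyForm r))
      (ExteriorAlgebra.lift ℂ ⟨v, hv⟩) fun p w => Algebra.commutes p _
  have hback : back.comp (toCoord r) = AlgHom.id (PolyRing r) (PolyForm r) := by
    apply ExteriorAlgebra.hom_ext
    apply (KaehlerDifferential.mvPolynomialBasis ℂ (Fin (r + 1))).ext
    intro i
    change back (toCoord r (ExteriorAlgebra.ι _ _)) = ExteriorAlgebra.ι _ _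
    rw [toCoord_ι, coordOneForm, Module.Basis.constr_basis, coordDX]
    refine (Algebra.TensorProduct.lift_tmul _ _ _ _ _).trans ?_
    rw [map_one, one_mul, ExteriorAlgebra.lift_ι_apply,
      Fintype.linearCombination_apply_single, one_smul,
      KaehlerDifferential.mvPolynomialBasis_apply]
  exact Function.LeftInverse.injective (g := back) fun w => DFunLike.congr_fun hback w

/-- The partial derivative `∂/∂x_i` of the coefficients of a form. -/
def coordPartial {r : ℕ} (i : Fin (r + 1)) : CoordForm r →ₗ[ℂ] CoordForm r :=
  LinearMap.rTensor _ (MvPolynomial.pderiv i : Derivation ℂ (PolyRing r) (PolyRing r)).toLinearMap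

lemma coordPartial_smul {r : ℕ} (i : Fin (r + 1)) (p : PolyRing r) (t : CoordForm r) :
    coordPartial i (p • t) = MvPolynomial.pderiv i p • t + p • coordPartial i t := by
  induction t using TensorProduct.induction_on with
  | zero => simp
  | tmul s w =>
    simp only [coordPartial, TensorProduct.smul_tmul', LinearMap.rTensor_tmul, smul_eq_mul]
    rw [← TensorProduct.add_tmul]
    congr 1
    change MvPolynomial.pderiv i (p * s) = _
    rw [Derivation.leibniz]
    simp only [smul_eq_mul]
    change p * MvPolynomial.pderiv i s + _ = _ + p * MvPolynomial.pderiv i s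
    ring
  | add a b ha hb => rw [smul_add, map_add, ha, hb, map_add, smul_add, smul_add]; abel

lemma coordPartial_coordDX_mul {r : ℕ} (i j : Fin (r + 1)) (t : CoordForm r) :
    coordPartial i (coordDX j * t) = coordDX j * coordPartial i t := by
  induction t using TensorProduct.induction_on with
  | zero => simp
  | tmul s w => simp [coordPartial, coordDX]
  | add a b ha hb => rw [mul_add, map_add, ha, hb, map_add, mul_add]

lemma coordPartial_coordOneForm_D_mul {r : ℕ} (i : Fin (r + 1)) (f : PolyRing r)
    (t : CoordForm r) :
    coordPartial i (coordOneForm r (KaehlerDifferential.D ℂ (PolyRing r) f) * t) =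
      coordOneForm r (KaehlerDifferential.D ℂ (PolyRing r) (MvPolynomial.pderiv i f)) * t +
        coordOneForm r (KaehlerDifferential.D ℂ (PolyRing r) f) * coordPartial i t := by
  simp only [coordOneForm_D, Finset.sum_mul, map_sum, smul_mul_assoc, coordPartial_smul,
    coordPartial_coordDX_mul]
  rw [← Finset.sum_add_distrib]
  refine Finset.sum_congr rfl fun j _ => ?_
  have : MvPolynomial.pderiv i (MvPolynomial.pderiv j f) =
      MvPolynomial.pderiv j (MvPolynomial.pderiv i f) := pderiv_pderiv_comm i j f
  rw [this]

/-- The exterior derivative `∑ dx_i ∧ ∂/∂x_i`. -/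
def coordExtDeriv (r : ℕ) : CoordForm r →ₗ[ℂ] CoordForm r :=
  ∑ i, LinearMap.mulLeft ℂ (coordDX i) ∘ₗ coordPartial i

lemma coordExtDeriv_apply {r : ℕ} (t : CoordForm r) :
    coordExtDeriv r t = ∑ i, coordDX i * coordPartial i t := by
  simp [coordExtDeriv]

lemma coordExtDeriv_one (r : ℕ) : coordExtDeriv r 1 = 0 := by
  rw [coordExtDeriv_apply]
  refine Finset.sum_eq_zero fun i _ => ?_
  simp [coordPartial, Algebra.TensorProduct.one_def]

lemma coordExtDeriv_smul {r : ℕ} (p : PolyRing r) (t : CoordForm r) :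
    coordExtDeriv r (p • t) =
      coordOneForm r (KaehlerDifferential.D ℂ (PolyRing r) p) * t + p • coordExtDeriv r t := by
  simp only [coordExtDeriv_apply, coordPartial_smul, coordOneForm_D, mul_add, mul_smul_comm,
    Finset.sum_add_distrib, Finset.sum_mul, Finset.smul_sum, smul_mul_assoc]

/-- `d(df ∧ t) = -df ∧ dt`. -/
lemma coordExtDeriv_coordOneForm_D_mul {r : ℕ} (f : PolyRing r) (t : CoordForm r) :
    coordExtDeriv r (coordOneForm r (KaehlerDifferential.D ℂ (PolyRing r) f) * t) =
      -(coordOneForm r (KaehlerDifferential.D ℂ (PolyRing r) f) * coordExtDeriv r t) := by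
  simp only [coordExtDeriv_apply, coordPartial_coordOneForm_D_mul, mul_add,
    Finset.sum_add_distrib, ← mul_assoc]
  have h1 : ∑ i, (coordDX i : CoordForm r) *
      coordOneForm r (KaehlerDifferential.D ℂ (PolyRing r) (MvPolynomial.pderiv i f)) = 0 := by
    simp only [coordOneForm_D, Finset.mul_sum, mul_smul_comm]
    exact sum_symm_smul_coordDX _ fun i j => pderiv_pderiv_comm j i f
  rw [← Finset.sum_mul, h1, zero_mul, zero_add, Finset.mul_sum, ← Finset.sum_neg_distrib]
  refine Finset.sum_congr rfl fun i _ => ?_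
  rw [← mul_assoc]
  refine eq_neg_of_add_eq_zero_left ?_
  rw [← add_mul]
  refine (congrArg (· * coordPartial i t) ?_).trans (zero_mul _)
  simp only [coordOneForm_D, Finset.mul_sum, Finset.sum_mul, ← Finset.sum_add_distrib]
  refine Finset.sum_eq_zero fun j _ => ?_
  rw [mul_smul_comm, smul_mul_assoc, ← smul_add, coordDX_mul_swap, neg_add_cancel, smul_zero]

lemma eulerField_eq_sum {r : ℕ} (f : PolyRing r) :
    eulerField r f = ∑ i, MvPolynomial.X i * MvPolynomial.pderiv i f := by
  have : eulerField r = ∑ i, (MvPolynomial.X i : PolyRing r) • MvPolynomial.pderiv i := by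
    apply MvPolynomial.derivation_ext
    intro j
    rw [eulerField, MvPolynomial.mkDerivation_X, ← Derivation.coeFnAddMonoidHom_apply, map_sum, Finset.sum_apply]
    simp [Derivation.coeFnAddMonoidHom, MvPolynomial.pderiv_X, Pi.single_apply]
  rw [this, ← Derivation.coeFnAddMonoidHom_apply, map_sum, Finset.sum_apply]
  simp [Derivation.coeFnAddMonoidHom]

lemma eulerField_of_isHomogeneous {r n : ℕ} {f : PolyRing r} (hf : f.IsHomogeneous n) :
    eulerField r f = n • f := by
  rw [eulerField_eq_sum, hf.sum_X_mul_pderiv]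

lemma contractEuler_D_mul {r n : ℕ} {f : PolyRing r} (hf : f.IsHomogeneous n) (ω : PolyForm r) :
    contractEuler (ExteriorAlgebra.ι _ (KaehlerDifferential.D ℂ (PolyRing r) f) * ω) =
      (n • f) • ω -
        ExteriorAlgebra.ι _ (KaehlerDifferential.D ℂ (PolyRing r) f) * contractEuler ω := by
  have := CliffordAlgebra.contractLeft_ι_mul
    (Q := (0 : QuadraticForm (PolyRing r) (Ω[PolyRing r⁄ℂ])))
    (d := (eulerField r).liftKaehlerDifferential) (KaehlerDifferential.D ℂ (PolyRing r) f) ω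
  rw [Derivation.liftKaehlerDifferential_comp_D, eulerField_of_isHomogeneous hf] at this
  exact this

/-- Cartan's formula for the radial field: `ω = df_1 ∧ ⋯ ∧ df_n` is closed and
`d (i_R ω) = (d_1 + ⋯ + d_n) ω` when each `f_j` is homogeneous of degree `d_j`. -/
lemma coordExtDeriv_contractEuler {r n : ℕ} (f : Fin n → PolyRing r) (d : Fin n → ℕ)
    (hf : ∀ j, (f j).IsHomogeneous (d j)) :
    coordExtDeriv r (toCoord r (ExteriorAlgebra.ιMulti (PolyRing r) n
        fun j => KaehlerDifferential.D ℂ (PolyRing r) (f j))) = 0 ∧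
      coordExtDeriv r (toCoord r (contractEuler (ExteriorAlgebra.ιMulti (PolyRing r) n
        fun j => KaehlerDifferential.D ℂ (PolyRing r) (f j)))) =
      (∑ j, d j) • toCoord r (ExteriorAlgebra.ιMulti (PolyRing r) n
        fun j => KaehlerDifferential.D ℂ (PolyRing r) (f j)) := by
  induction n with
  | zero =>
    rw [ExteriorAlgebra.ιMulti_zero_apply, map_one, coordExtDeriv_one, contractEuler,
      CliffordAlgebra.contractLeft_one]
    simp
  | succ n ih =>
    obtain ⟨h1, h2⟩ := ih (fun j => f j.succ) (fun j => d j.succ) fun j => hf j.succ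
    rw [ExteriorAlgebra.ιMulti_succ_apply]
    change coordExtDeriv r (toCoord r (_ * ExteriorAlgebra.ιMulti (PolyRing r) n
        fun j => KaehlerDifferential.D ℂ (PolyRing r) (f j.succ))) = 0 ∧
      coordExtDeriv r (toCoord r (contractEuler (_ * ExteriorAlgebra.ιMulti (PolyRing r) n
        fun j => KaehlerDifferential.D ℂ (PolyRing r) (f j.succ)))) =
      _ • toCoord r (_ * ExteriorAlgebra.ιMulti (PolyRing r) n
        fun j => KaehlerDifferential.D ℂ (PolyRing r) (f j.succ))
    set ω := ExteriorAlgebra.ιMulti (PolyRing r) n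
      fun j => KaehlerDifferential.D ℂ (PolyRing r) (f j.succ)
    rw [contractEuler_D_mul (hf 0), map_mul, toCoord_ι, coordExtDeriv_coordOneForm_D_mul, h1,
      mul_zero, neg_zero, map_sub, map_smul, map_mul, toCoord_ι, map_sub, coordExtDeriv_smul, h1,
      smul_zero, add_zero, coordExtDeriv_coordOneForm_D_mul, h2, sub_neg_eq_add,
      Fin.sum_univ_succ, add_smul, map_nsmul, map_nsmul, smul_mul_assoc, mul_smul_comm]
    exact ⟨rfl, rfl⟩

/-- A wedge of exact forms is determined, up to the same scalar, by its contraction with the radial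
field. -/
lemma wedgeD_eq_smul_of_contractEuler {r q : ℕ} {d : Fin (q + 1) → ℕ}
    {F G : Fin (q + 1) → PolyRing r} (hF : ∀ j, (F j).IsHomogeneous (d j))
    (hG : ∀ j, (G j).IsHomogeneous (d j)) (hd : ∑ j, d j ≠ 0) {c : ℂ}
    (h : contractEuler (wedgeD G) = c • contractEuler (wedgeD F)) :
    wedgeD G = c • wedgeD F := by
  have hFd := (coordExtDeriv_contractEuler F d hF).2
  have hGd := (coordExtDeriv_contractEuler G d hG).2
  change coordExtDeriv r (toCoord r (contractEuler (wedgeD F))) = _ • toCoord r (wedgeD F) at hFd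
  change coordExtDeriv r (toCoord r (contractEuler (wedgeD G))) = _ • toCoord r (wedgeD G) at hGd
  have hsmul : ∀ ω : PolyForm r, toCoord r (c • ω) = c • toCoord r ω := fun ω => by
    rw [← algebraMap_smul (PolyRing r), map_smul, algebraMap_smul]
  rw [h, hsmul, map_smul, hFd, smul_comm] at hGd
  apply toCoord_injective r
  rw [hsmul]
  have hd' : ((∑ j, d j : ℕ) : ℂ) ≠ 0 := by exact_mod_cast hd
  apply smul_right_injective _ hd'
  simp only [Nat.cast_smul_eq_nsmul]
  exact hGd.symm

/-! ### Division by matrices whose minors have no common factor -/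

/-- Matrices with proportional maximal minors have proportional row spans: the entries of
`adj(N_I) N` are maximal minors by Cramer's rule, so `adj(N_I) N = c adj(M_I) M`. -/
lemma det_smul_eq_mul_of_minors {S m n : Type*} [CommRing S] [IsDomain S] [Fintype m]
    [DecidableEq m] (M N : Matrix m n S) (c : S) (hc : c ≠ 0)
    (h : ∀ I : m → n, (N.submatrix id I).det = c * (M.submatrix id I).det) (I : m → n) :
    (M.submatrix id I).det • N =
      N.submatrix id I * (M.submatrix id I).adjugate * M := by
  have adj : ∀ (L : Matrix m n S) k i, ((L.submatrix id I).adjugate * L) k i =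
      (L.submatrix id (Function.update I k i)).det := by
    intro L k i
    have h1 := congrFun (Matrix.cramer_eq_adjugate_mulVec (L.submatrix id I) fun j => L j i) k
    rw [Matrix.cramer_apply] at h1
    rw [Matrix.mul_apply]
    refine h1.symm.trans ?_
    congr 1
    ext a b
    by_cases hb : b = k
    · subst hb; simp
    · simp [hb]
  have hadj : (N.submatrix id I).adjugate * N = c • ((M.submatrix id I).adjugate * M) := by
    ext k i
    rw [Matrix.smul_apply, adj, adj, h, smul_eq_mul]
  have h2 : c • ((M.submatrix id I).det • N) =
      c • (N.submatrix id I * (M.submatrix id I).adjugate * M) := by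
    calc c • ((M.submatrix id I).det • N) = (N.submatrix id I).det • N := by
          rw [h, smul_smul]
      _ = N.submatrix id I * ((N.submatrix id I).adjugate * N) := by
          rw [← Matrix.mul_assoc, Matrix.mul_adjugate, Matrix.smul_mul, Matrix.one_mul]
      _ = _ := by rw [hadj, Matrix.mul_smul, Matrix.mul_assoc]
  ext j i
  have := congrFun (congrFun h2 j) i
  simp only [Matrix.smul_apply, smul_eq_mul] at this ⊢
  exact mul_left_cancel₀ hc this

lemma eq_zero_of_vecMul_eq_zero_of_minor {S m n : Type*} [CommRing S] [IsDomain S] [Fintype m]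
    [DecidableEq m] {M : Matrix m n S} {I : m → n} (hI : (M.submatrix id I).det ≠ 0)
    {a : m → S} (h : Matrix.vecMul a M = 0) : a = 0 := by
  apply Matrix.eq_zero_of_vecMul_eq_zero hI
  ext i
  exact congrFun h (I i)

lemma dvd_of_forall_dvd_mul {S ι : Type*} [CommRing S] [IsDomain S] [UniqueFactorizationMonoid S]
    {m b : S} (hm : m ≠ 0) (M : ι → S) (h : ∀ i, m ∣ b * M i)
    (hM : ∀ p, Prime p → ∃ i, ¬p ∣ M i) : m ∣ b := by
  obtain ⟨m', b', g, hcop, rfl, rfl⟩ := UniqueFactorizationMonoid.exists_reduced_factors m hm b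
  have hg : g ≠ 0 := left_ne_zero_of_mul hm
  have hm' : m' ≠ 0 := right_ne_zero_of_mul hm
  have hdvd : ∀ i, m' ∣ M i := by
    intro i
    have h1 : m' ∣ b' * M i := by
      have := h i
      rw [mul_assoc] at this
      exact (mul_dvd_mul_iff_left hg).1 this
    exact hcop.dvd_of_dvd_mul_left h1
  have hunit : IsUnit m' := by
    by_contra hu
    obtain ⟨p, hp, hpm⟩ := WfDvdMonoid.exists_irreducible_factor hu hm'
    obtain ⟨i, hi⟩ := hM p hp.prime
    exact hi (hpm.trans (hdvd i))
  exact mul_dvd_mul_left g hunit.dvd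

/-- Division by a matrix whose maximal minors have no common prime factor: a row that lies in the
row span after multiplication by each maximal minor lies in the row span. -/
lemma exists_eq_vecMul_of_minors {S m n : Type*} [CommRing S] [IsDomain S]
    [UniqueFactorizationMonoid S] [Fintype m] [DecidableEq m] (M : Matrix m n S)
    (hne : ∃ I : m → n, (M.submatrix id I).det ≠ 0)
    (hM : ∀ p, Prime p → ∃ I : m → n, ¬p ∣ (M.submatrix id I).det) (w : n → S)
    (hw : ∀ I : m → n, ∃ b, (M.submatrix id I).det • w = Matrix.vecMul b M) :
    ∃ a, w = Matrix.vecMul a M := by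
  obtain ⟨I₀, hI₀⟩ := hne
  choose b hb using hw
  have hcross : ∀ I, (M.submatrix id I).det • b I₀ = (M.submatrix id I₀).det • b I := by
    intro I
    rw [← sub_eq_zero]
    apply eq_zero_of_vecMul_eq_zero_of_minor hI₀
    rw [Matrix.sub_vecMul, Matrix.smul_vecMul, Matrix.smul_vecMul, ← hb, ← hb, smul_comm, sub_self]
  have hdvd : ∀ k, (M.submatrix id I₀).det ∣ b I₀ k := fun k =>
    dvd_of_forall_dvd_mul hI₀ (fun I => (M.submatrix id I).det)
      (fun I => ⟨b I k, by
        have := congrFun (hcross I) k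
        simp only [Pi.smul_apply, smul_eq_mul] at this
        rw [mul_comm, this]⟩) hM
  choose a ha using hdvd
  refine ⟨a, ?_⟩
  have h1 : b I₀ = (M.submatrix id I₀).det • a := funext ha
  have h2 := hb I₀
  rw [h1, Matrix.smul_vecMul] at h2
  exact smul_right_injective _ hI₀ h2

/-- By Krull's principal ideal theorem and the Nullstellensatz, a common prime factor of the minors
would make the singular set contain a hypersurface. -/
lemma exists_not_dvd_jacobianMinor {r q : ℕ} {F : Fin (q + 1) → PolyRing r}
    (hsing : 2 ≤ algCodim (singSet (wedgeD F))) (p : PolyRing r) (hp : Prime p) :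
    ∃ I, ¬p ∣ jacobianMinor F I := by
  by_contra! hall
  have hprime : (Ideal.span {p}).IsPrime := (Ideal.span_singleton_prime hp.ne_zero).2 hp
  have hsub : MvPolynomial.zeroLocus ℂ (Ideal.span {p}) ⊆ singSet (wedgeD F) := by
    intro x hx
    refine mem_singSet_of_forall_eval F x fun I => ?_
    have := hx _ (Ideal.mem_span_singleton.2 (hall I))
    rwa [MvPolynomial.aeval_eq_eval] at this
  have hle : MvPolynomial.vanishingIdeal ℂ (singSet (wedgeD F)) ≤ Ideal.span {p} := by
    have := MvPolynomial.vanishingIdeal_anti_mono (k := ℂ) hsub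
    rwa [MvPolynomial.IsPrime.vanishingIdeal_zeroLocus] at this
  have h1 : algCodim (singSet (wedgeD F)) ≤ 1 :=
    (Ideal.height_mono hle).trans (Ideal.height_span_singleton_le_one hp.not_isUnit)
  exact absurd (hsing.trans h1) (by decide)

/-- The gradients of the coefficients of an exact `1`-form `∑ a_k dF_k` are combinations of the
`dF_k`, up to a minor. The equation `∑ da_k ∧ dF_k = 0` says that `J(a)ᵀ J(F)` is symmetric. -/
lemma minor_smul_gradient_coeff {r q : ℕ} {F : Fin (q + 1) → PolyRing r} {g : PolyRing r}
    {a : Fin (q + 1) → PolyRing r}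
    (h : (fun i => MvPolynomial.pderiv i g) = Matrix.vecMul a (jacobian F)) (k : Fin (q + 1))
    (I : Fin (q + 1) → Fin (r + 1)) :
    ∃ b, jacobianMinor F I • (fun i => MvPolynomial.pderiv i (a k)) =
      Matrix.vecMul b (jacobian F) := by
  have hsymm : (jacobian a).transpose * jacobian F = (jacobian F).transpose * jacobian a := by
    refine Matrix.ext fun i j => ?_
    have key : ∀ i j, MvPolynomial.pderiv i (MvPolynomial.pderiv j g) =
        ((jacobian a).transpose * jacobian F) i j +
          ∑ k, a k * MvPolynomial.pderiv i (MvPolynomial.pderiv j (F k)) := by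
      intro i j
      rw [show MvPolynomial.pderiv j g = ∑ k, a k * MvPolynomial.pderiv j (F k) from congrFun h j,
        map_sum, Matrix.mul_apply, ← Finset.sum_add_distrib]
      refine Finset.sum_congr rfl fun k _ => ?_
      rw [Derivation.leibniz]
      simp only [jacobian, smul_eq_mul, Matrix.transpose_apply, Matrix.of_apply]
      ring
    have h1 := key i j
    have h2 := key j i
    rw [pderiv_pderiv_comm, h2] at h1
    have h3 : ∑ k, a k * MvPolynomial.pderiv j (MvPolynomial.pderiv i (F k)) =
        ∑ k, a k * MvPolynomial.pderiv i (MvPolynomial.pderiv j (F k)) :=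
      Finset.sum_congr rfl fun k _ => by rw [pderiv_pderiv_comm]
    rw [h3] at h1
    rw [← add_right_cancel h1, Matrix.mul_apply, Matrix.mul_apply]
    exact Finset.sum_congr rfl fun k _ => mul_comm (jacobian a k j) (jacobian F k i)
  have hsub : ((jacobian F).submatrix id I).transpose * jacobian a =
      ((jacobian a).submatrix id I).transpose * jacobian F := by
    refine Matrix.ext fun i j => ?_
    exact (congrFun (congrFun hsymm (I i)) j).symm
  refine ⟨(((jacobian F).submatrix id I).transpose.adjugate *
    ((jacobian a).submatrix id I).transpose) k, ?_⟩
  have h4 : jacobianMinor F I • jacobian a = ((jacobian F).submatrix id I).transpose.adjugate *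
      ((jacobian a).submatrix id I).transpose * jacobian F := by
    rw [Matrix.mul_assoc, ← hsub, ← Matrix.mul_assoc, Matrix.adjugate_mul, Matrix.det_transpose,
      Matrix.smul_mul, Matrix.one_mul, jacobianMinor]
  have h5 := congrFun h4 k
  ext1 i
  exact congrFun h5 i

/-! ### Homogeneous components -/

lemma homogeneousComponent_mul_of_isHomogeneous {σ R : Type*} [CommRing R] {a b : MvPolynomial σ R}
    {m : ℕ} (hb : b.IsHomogeneous m) (n : ℕ) :
    MvPolynomial.homogeneousComponent n (a * b) =
      if m ≤ n then MvPolynomial.homogeneousComponent (n - m) a * b else 0 := by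
  induction a using MvPolynomial.monomial_add_induction_on with
  | C c =>
    rw [MvPolynomial.homogeneousComponent_of_mem ((MvPolynomial.isHomogeneous_C _ c).mul hb),
      MvPolynomial.homogeneousComponent_of_mem (MvPolynomial.isHomogeneous_C _ c)]
    split_ifs <;> first | rfl | omega
  | monomial_add s c f _ _ ih =>
    have hs : (MvPolynomial.monomial s c).IsHomogeneous s.degree :=
      MvPolynomial.isHomogeneous_monomial c rfl
    rw [add_mul, map_add, map_add, ih, MvPolynomial.homogeneousComponent_of_mem (hs.mul hb),
      MvPolynomial.homogeneousComponent_of_mem hs]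
    split_ifs <;> first | omega | simp [add_mul]

/-- If `dg = ∑ a_k dF_k` with `g` homogeneous of degree `e`, the coefficients may be taken homogeneous
of degree `e - d_k`, and zero when `e < d_k`: replace each `a_k` by its component of that degree. -/
lemma exists_isHomogeneous_coeff {r q : ℕ} {d : Fin (q + 1) → ℕ} {F : Fin (q + 1) → PolyRing r}
    (hF : ∀ j, (F j).IsHomogeneous (d j)) (hd : ∀ j, d j ≠ 0) {e : ℕ} (he : e ≠ 0)
    {g : PolyRing r} (hg : g.IsHomogeneous e) {a : Fin (q + 1) → PolyRing r}
    (h : (fun i => MvPolynomial.pderiv i g) = Matrix.vecMul a (jacobian F)) :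
    ∃ a' : Fin (q + 1) → PolyRing r,
      (∀ k, d k ≤ e → (a' k).IsHomogeneous (e - d k)) ∧ (∀ k, ¬d k ≤ e → a' k = 0) ∧
      (fun i => MvPolynomial.pderiv i g) = Matrix.vecMul a' (jacobian F) := by
  refine ⟨fun k => if d k ≤ e then MvPolynomial.homogeneousComponent (e - d k) (a k) else 0,
    fun k hk => ?_, fun k hk => if_neg hk, ?_⟩
  · simp only [if_pos hk]
    exact MvPolynomial.homogeneousComponent_isHomogeneous _ _
  · ext1 i
    have h1 : MvPolynomial.pderiv i g = ∑ k, a k * MvPolynomial.pderiv i (F k) := congrFun h i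
    have h2 : MvPolynomial.homogeneousComponent (e - 1) (MvPolynomial.pderiv i g) =
        MvPolynomial.pderiv i g := MvPolynomial.homogeneousComponent_eq_self hg.pderiv
    change _ = ∑ k, (if d k ≤ e then _ else 0) * MvPolynomial.pderiv i (F k)
    rw [← h2, h1, map_sum]
    refine Finset.sum_congr rfl fun k _ => ?_
    rw [homogeneousComponent_mul_of_isHomogeneous (hF k).pderiv]
    have := hd k
    by_cases hk : d k ≤ e
    · rw [if_pos (by omega), if_pos hk]
      rw [show e - 1 - (d k - 1) = e - d k by omega]
    · rw [if_neg (by omega), if_neg hk, zero_mul]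

lemma isHomogeneousInt_iff {r : ℕ} (p : PolyRing r) (e : ℤ) :
    IsHomogeneousInt p e ↔ MvPolynomial.IsWeightedHomogeneous (fun _ => (1 : ℤ)) p e := by
  refine forall_congr' fun m => ?_
  rw [MvPolynomial.mem_support_iff]
  rw [Finsupp.weight_apply, Finsupp.degree_apply]
  simp [Finsupp.sum]

lemma isHomogeneousInt_sub_of_isHomogeneous {r : ℕ} {p : PolyRing r} {m n : ℕ}
    (h1 : n ≤ m → p.IsHomogeneous (m - n)) (h2 : ¬n ≤ m → p = 0) :
    IsHomogeneousInt p ((m : ℤ) - n) := by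
  intro s hs
  by_cases hmn : n ≤ m
  · have := h1 hmn (MvPolynomial.mem_support_iff.1 hs)
    replace this : (Finsupp.weight (fun _ => 1)) s = m - n := this
    rw [← Finsupp.degree_eq_weight_one] at this
    omega
  · rw [h2 hmn] at hs
    simp at hs

/-- A homogeneous change of coefficients between forms of the same degrees has constant
determinant. -/
lemma det_eq_C_of_isHomogeneousInt {r q : ℕ} {d : Fin (q + 1) → ℕ}
    (A : Matrix (Fin (q + 1)) (Fin (q + 1)) (PolyRing r))
    (hA : ∀ j k, IsHomogeneousInt (A j k) ((d j : ℤ) - d k)) :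
    ∃ c : ℂ, A.det = MvPolynomial.C c := by
  have h : MvPolynomial.IsWeightedHomogeneous (fun _ => (1 : ℤ)) A.det 0 := by
    rw [Matrix.det_apply]
    refine MvPolynomial.IsWeightedHomogeneous.sum _ _ _ fun σ _ => ?_
    have hprod := MvPolynomial.IsWeightedHomogeneous.prod Finset.univ (fun i => A (σ i) i)
      (fun i => ((d (σ i) : ℤ) - d i)) (w := fun _ => (1 : ℤ))
      fun i _ => (isHomogeneousInt_iff _ _).1 (hA _ _)
    rw [Finset.sum_sub_distrib, Equiv.sum_comp σ (fun i => (d i : ℤ)), sub_self] at hprod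
    rcases Int.units_eq_one_or (Equiv.Perm.sign σ) with hs | hs
    · rw [hs, one_smul]; exact hprod
    · rw [hs, Units.neg_smul, one_smul]; exact hprod.neg
  rw [← isHomogeneousInt_iff] at h
  have hdeg : A.det.totalDegree = 0 := by
    rw [MvPolynomial.totalDegree_eq_zero_iff]
    intro m hm i
    have h0 : m.degree = 0 := by exact_mod_cast h m hm
    rw [Finsupp.degree_eq_zero_iff] at h0
    rw [h0]; rfl
  exact ⟨_, MvPolynomial.totalDegree_eq_zero_iff_eq_C.1 hdeg⟩

lemma degree_ne_zero_of_wedgeD_ne_zero {r q : ℕ} {d : Fin (q + 1) → ℕ}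
    {F : Fin (q + 1) → PolyRing r} (hF : ∀ j, (F j).IsHomogeneous (d j)) (hdF : wedgeD F ≠ 0)
    (j : Fin (q + 1)) : d j ≠ 0 := by
  intro hj
  apply hdF
  have h := hF j
  rw [hj, ← MvPolynomial.totalDegree_zero_iff_isHomogeneous] at h
  refine AlternatingMap.map_coord_zero _ j ?_
  rw [MvPolynomial.totalDegree_eq_zero_iff_eq_C.1 h]
  exact Derivation.map_algebraMap _ _

/-! ### Polynomials in `F` -/

lemma pderiv_aeval {r q : ℕ} (F : Fin (q + 1) → PolyRing r)
    (f : MvPolynomial (Fin (q + 1)) ℂ) (i : Fin (r + 1)) :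
    MvPolynomial.pderiv i (MvPolynomial.aeval F f) =
      ∑ k, MvPolynomial.aeval F (MvPolynomial.pderiv k f) * MvPolynomial.pderiv i (F k) := by
  induction f using MvPolynomial.induction_on with
  | C c => simp [MvPolynomial.algebraMap_eq]
  | add a b ha hb => simp only [map_add, ha, hb, add_mul, Finset.sum_add_distrib]
  | mul_X a k ha =>
    simp only [map_mul, MvPolynomial.aeval_X, Derivation.leibniz, ha, smul_eq_mul, map_add,
      add_mul, Finset.sum_add_distrib, MvPolynomial.pderiv_X, Finset.mul_sum]
    congr 1
    · rw [Finset.sum_eq_single k]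
      · simp
      · intro l _ hl
        simp [Pi.single_eq_of_ne hl.symm]
      · simp
    · exact Finset.sum_congr rfl fun l _ => by ring

lemma gradient_aeval {r q : ℕ} (F : Fin (q + 1) → PolyRing r)
    (f : MvPolynomial (Fin (q + 1)) ℂ) :
    (fun i => MvPolynomial.pderiv i (MvPolynomial.aeval F f)) =
      Matrix.vecMul (fun k => MvPolynomial.aeval F (MvPolynomial.pderiv k f)) (jacobian F) :=
  funext fun i => pderiv_aeval F f i

lemma eq_C_of_forall_pderiv_eq_zero {σ : Type*} (f : MvPolynomial σ ℂ)
    (h : ∀ k, MvPolynomial.pderiv k f = 0) : f = MvPolynomial.C (f.coeff 0) := by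
  classical
  ext m
  rw [MvPolynomial.coeff_C]
  split_ifs with hm
  · rw [hm]
  · obtain ⟨k, hk⟩ := Finsupp.ne_iff.1 (Ne.symm hm)
    have h1 := MvPolynomial.coeff_pderiv (i := k) f (m - Finsupp.single k 1)
    have h2 : m - Finsupp.single k 1 + Finsupp.single k 1 = m := by
      ext l
      by_cases hl : l = k
      · subst hl
        have : m l ≠ 0 := hk
        simp only [Finsupp.add_apply, Finsupp.tsub_apply, Finsupp.single_eq_same]
        omega
      · simp [Finsupp.single_eq_of_ne hl]
    rw [h k, h2, MvPolynomial.coeff_zero] at h1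
    rcases mul_eq_zero.1 h1.symm with h3 | h3
    · exact h3
    · exact absurd h3 (Nat.cast_add_one_ne_zero _)

lemma totalDegree_pderiv_lt {σ : Type*} (f : MvPolynomial σ ℂ) (k : σ)
    (h : MvPolynomial.pderiv k f ≠ 0) :
    (MvPolynomial.pderiv k f).totalDegree < f.totalDegree := by
  classical
  obtain ⟨m, hm, hdeg⟩ := Finset.exists_mem_eq_sup _ (MvPolynomial.support_nonempty.2 h)
    fun s => s.sum fun _ e => e
  rw [MvPolynomial.mem_support_iff, MvPolynomial.coeff_pderiv] at hm
  have h1 := MvPolynomial.le_totalDegree (MvPolynomial.mem_support_iff.2 (left_ne_zero_of_mul hm))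
  rw [Finsupp.sum_add_index' (fun _ => rfl) (fun _ _ _ => rfl),
    Finsupp.sum_single_index rfl] at h1
  rw [MvPolynomial.totalDegree, hdeg]
  exact h1

/-- The Jacobian criterion: polynomials with independent differentials are algebraically
independent. A relation of least degree has its partial derivatives as relations of lower degree. -/
lemma aeval_injective_of_wedgeD_ne_zero {r q : ℕ} {F : Fin (q + 1) → PolyRing r}
    (hdF : wedgeD F ≠ 0) :
    Function.Injective (MvPolynomial.aeval F : MvPolynomial (Fin (q + 1)) ℂ →ₐ[ℂ] PolyRing r) := by
  obtain ⟨I, hI⟩ := (wedgeD_ne_zero_iff F).1 hdF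
  rw [injective_iff_map_eq_zero]
  intro f
  induction hn : f.totalDegree using Nat.strong_induction_on generalizing f with
  | _ n ih =>
    intro hf
    have hrel : ∀ k, MvPolynomial.aeval F (MvPolynomial.pderiv k f) = 0 := by
      refine fun k => congrFun (eq_zero_of_vecMul_eq_zero_of_minor hI ((gradient_aeval F f).symm.trans
        ?_) : (fun k => MvPolynomial.aeval F (MvPolynomial.pderiv k f)) = 0) k
      rw [hf]
      ext1 i
      exact map_zero _
    have hzero : ∀ k, MvPolynomial.pderiv k f = 0 := by
      intro k
      by_contra hk
      exact hk (ih _ (hn ▸ totalDegree_pderiv_lt f k hk) _ rfl (hrel k))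
    have hC := eq_C_of_forall_pderiv_eq_zero f hzero
    rw [hC, MvPolynomial.aeval_C, MvPolynomial.algebraMap_eq] at hf
    rw [hC, MvPolynomial.C_eq_zero.1 hf, MvPolynomial.C_0]

lemma isHomogeneous_aeval {r q n : ℕ} {d : Fin (q + 1) → ℕ} {F : Fin (q + 1) → PolyRing r}
    (hF : ∀ j, (F j).IsHomogeneous (d j)) {f : MvPolynomial (Fin (q + 1)) ℂ}
    (hf : f.IsWeightedHomogeneous d n) : (MvPolynomial.aeval F f : PolyRing r).IsHomogeneous n := by
  rw [MvPolynomial.aeval_def, MvPolynomial.eval₂_eq']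
  refine MvPolynomial.IsHomogeneous.sum _ _ _ fun m hm => ?_
  have hm' := hf (MvPolynomial.mem_support_iff.1 hm)
  have h1 : (∏ i, F i ^ m i).IsHomogeneous (∑ i, d i * m i) :=
    MvPolynomial.IsHomogeneous.prod _ _ _ fun i _ => (hF i).pow _
  have h2 : ∑ i, d i * m i = n := by
    rw [← hm', Finsupp.weight_apply, Finsupp.sum_fintype _ _ (by simp)]
    exact Finset.sum_congr rfl fun i _ => by rw [smul_eq_mul, mul_comm]
  rw [h2] at h1
  exact h1.C_mul _

lemma aeval_weightedHomogeneousComponent {r q : ℕ} {d : Fin (q + 1) → ℕ}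
    {F : Fin (q + 1) → PolyRing r} (hF : ∀ j, (F j).IsHomogeneous (d j)) (n : ℕ)
    (f : MvPolynomial (Fin (q + 1)) ℂ) :
    MvPolynomial.aeval F (MvPolynomial.weightedHomogeneousComponent d n f) =
      MvPolynomial.homogeneousComponent n (MvPolynomial.aeval F f) := by
  induction f using MvPolynomial.induction_on' with
  | monomial m c =>
    have hm := MvPolynomial.isWeightedHomogeneous_monomial d m c rfl
    rw [MvPolynomial.weightedHomogeneousComponent_of_mem hm,
      MvPolynomial.homogeneousComponent_of_mem (isHomogeneous_aeval hF hm)]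
    split_ifs
    · rfl
    · rw [map_zero]
  | add a b ha hb => simp only [map_add, ha, hb]

/-- A homogeneous polynomial whose differential is a combination of the `dF_k` is a polynomial in
the `F_k`. The coefficients `a_k` have lower degree, their differentials are again combinations of
the `dF_k`, and `g` is recovered from them by Euler's identity `e g = ∑ d_k a_k F_k`. -/
lemma exists_eq_aeval_of_gradient {r q : ℕ} {d : Fin (q + 1) → ℕ} {F : Fin (q + 1) → PolyRing r}
    (hF : ∀ j, (F j).IsHomogeneous (d j)) (hdF : wedgeD F ≠ 0)
    (hsing : 2 ≤ algCodim (singSet (wedgeD F))) (e : ℕ) (g : PolyRing r) (hg : g.IsHomogeneous e)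
    (h : ∃ a, (fun i => MvPolynomial.pderiv i g) = Matrix.vecMul a (jacobian F)) :
    ∃ f : MvPolynomial (Fin (q + 1)) ℂ, g = MvPolynomial.aeval F f := by
  have hd := degree_ne_zero_of_wedgeD_ne_zero hF hdF
  induction e using Nat.strong_induction_on generalizing g with
  | _ e ih =>
    rcases Nat.eq_zero_or_pos e with rfl | he
    · rw [← MvPolynomial.totalDegree_zero_iff_isHomogeneous] at hg
      refine ⟨MvPolynomial.C (g.coeff 0), ?_⟩
      rw [MvPolynomial.aeval_C]
      exact MvPolynomial.totalDegree_eq_zero_iff_eq_C.1 hg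
    obtain ⟨a, ha⟩ := h
    obtain ⟨a, ha1, ha0, ha⟩ := exists_isHomogeneous_coeff hF hd he.ne' hg ha
    have hpoly : ∀ k, ∃ f : MvPolynomial (Fin (q + 1)) ℂ, a k = MvPolynomial.aeval F f := by
      intro k
      by_cases hk : d k ≤ e
      · refine ih (e - d k) (by have := hd k; omega) (a k) (ha1 k hk) ?_
        exact exists_eq_vecMul_of_minors (jacobian F) ((wedgeD_ne_zero_iff F).1 hdF)
          (exists_not_dvd_jacobianMinor hsing) _ fun I => minor_smul_gradient_coeff ha k I
      · exact ⟨0, by rw [ha0 k hk, map_zero]⟩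
    choose f hf using hpoly
    have heuler : (e : ℂ) • g = ∑ k, (d k : ℂ) • (a k * F k) := by
      have h1 := hg.sum_X_mul_pderiv
      have h2 : ∀ i, MvPolynomial.pderiv i g = ∑ k, a k * MvPolynomial.pderiv i (F k) :=
        congrFun ha
      simp only [h2, Finset.mul_sum] at h1
      rw [Finset.sum_comm] at h1
      rw [Nat.cast_smul_eq_nsmul, ← h1]
      refine Finset.sum_congr rfl fun k _ => ?_
      rw [Nat.cast_smul_eq_nsmul, ← mul_smul_comm, ← (hF k).sum_X_mul_pderiv, Finset.mul_sum]
      exact Finset.sum_congr rfl fun i _ => by ring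
    refine ⟨(e : ℂ)⁻¹ • ∑ k, (d k : ℂ) • (f k * MvPolynomial.X k), ?_⟩
    simp only [map_smul, map_sum, map_mul, MvPolynomial.aeval_X, ← hf]
    rw [← heuler, smul_smul, inv_mul_cancel₀ (by exact_mod_cast he.ne'), one_smul]

lemma wedgeD_eq_det_smul {r q : ℕ} {F G : Fin (q + 1) → PolyRing r}
    (A : Matrix (Fin (q + 1)) (Fin (q + 1)) (PolyRing r)) (h : jacobian G = A * jacobian F) {c : ℂ}
    (hc : A.det = MvPolynomial.C c) : wedgeD G = c • wedgeD F := by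
  rw [wedgeD_eq_smul_iff]
  intro I
  have : (jacobian G).submatrix id I = A * (jacobian F).submatrix id I := by
    rw [h]
    rfl
  rw [jacobianMinor, this, Matrix.det_mul, hc, ← MvPolynomial.smul_eq_C_mul, jacobianMinor]

/-- Composition with a polynomial map multiplies `dF_0 ∧ ⋯ ∧ dF_q` by a Jacobian determinant; when
degrees are preserved, this is a constant, read off at the origin, where `F` vanishes. -/
lemma wedgeD_aeval {r q : ℕ} {d : Fin (q + 1) → ℕ} {F : Fin (q + 1) → PolyRing r}
    (hF : ∀ j, (F j).IsHomogeneous (d j)) (hdF : wedgeD F ≠ 0)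
    (f : Fin (q + 1) → MvPolynomial (Fin (q + 1)) ℂ)
    (hf : ∀ j, (MvPolynomial.aeval F (f j) : PolyRing r).IsHomogeneous (d j)) :
    wedgeD (fun j => (MvPolynomial.aeval F (f j) : PolyRing r)) =
      (jacobianAtZero f).det • wedgeD F := by
  have hd := degree_ne_zero_of_wedgeD_ne_zero hF hdF
  obtain ⟨I, hI⟩ := (wedgeD_ne_zero_iff F).1 hdF
  let A : Matrix (Fin (q + 1)) (Fin (q + 1)) (PolyRing r) :=
    Matrix.of fun j k => MvPolynomial.aeval F (MvPolynomial.pderiv k (f j))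
  have hA : ∀ j k, IsHomogeneousInt (A j k) ((d j : ℤ) - d k) := by
    intro j k
    obtain ⟨a, h1, h2, h3⟩ :=
      exists_isHomogeneous_coeff hF hd (hd j) (hf j) (gradient_aeval F (f j))
    have heq : a = A j := by
      rw [← sub_eq_zero]
      apply eq_zero_of_vecMul_eq_zero_of_minor hI
      rw [Matrix.sub_vecMul, ← h3, gradient_aeval, sub_eq_zero]
      rfl
    rw [← heq]
    exact isHomogeneousInt_sub_of_isHomogeneous (h1 k) (h2 k)
  obtain ⟨c, hc⟩ := det_eq_C_of_isHomogeneousInt A hA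
  have hc0 : c = (jacobianAtZero f).det := by
    have hF0 : ∀ j, MvPolynomial.eval 0 (F j) = 0 := by
      intro j
      rw [MvPolynomial.eval_zero, MvPolynomial.constantCoeff_eq]
      exact (hF j).coeff_eq_zero (by simpa using (hd j).symm)
    have h1 := congrArg (MvPolynomial.eval 0) hc
    rw [MvPolynomial.eval_C, RingHom.map_det] at h1
    rw [← h1]
    congr 1
    ext j k
    change MvPolynomial.eval 0 (MvPolynomial.aeval F (MvPolynomial.pderiv k (f j))) =
      MvPolynomial.eval 0 (MvPolynomial.pderiv k (f j))
    rw [MvPolynomial.aeval_def, MvPolynomial.eval₂_comp_left (MvPolynomial.eval 0),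
      show ⇑(MvPolynomial.eval 0) ∘ F = 0 from funext hF0,
      show (MvPolynomial.eval 0 : PolyRing r →+* ℂ).comp (algebraMap ℂ (PolyRing r)) =
        RingHom.id ℂ from RingHom.ext fun z => MvPolynomial.eval_C z]
    rfl
  rw [← hc0]
  refine wedgeD_eq_det_smul A ?_ hc
  refine Matrix.ext fun j i => ?_
  exact pderiv_aeval F (f j) i

end

/-! ### The equivalences and the fiber -/

theorem propositionP (r q : ℕ) (d : Fin (q + 1) → ℕ) (F : Fin (q + 1) → PolyRing r)
    (hF : ∀ j, (F j).IsHomogeneous (d j)) (hdF : wedgeD F ≠ 0)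
    (hsing : 2 ≤ algCodim (singSet (wedgeD F))) :
    (∀ G : Fin (q + 1) → PolyRing r, (∀ j, (G j).IsHomogeneous (d j)) → wedgeD G ≠ 0 →
      List.TFAE [
        ∃ c : ℂ, c ≠ 0 ∧ contractEuler (wedgeD G) = c • contractEuler (wedgeD F),
        ∃ c : ℂ, c ≠ 0 ∧ wedgeD G = c • wedgeD F,
        ∃ A : Fin (q + 1) → Fin (q + 1) → PolyRing r,
          (∀ j k, IsHomogeneousInt (A j k) ((d j : ℤ) - (d k : ℤ))) ∧
          ∀ j, KaehlerDifferential.D ℂ (PolyRing r) (G j) =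
            ∑ k, A j k • KaehlerDifferential.D ℂ (PolyRing r) (F k),
        ∃ f : Fin (q + 1) → MvPolynomial (Fin (q + 1)) ℂ, ∀ j, G j = MvPolynomial.aeval F (f j),
        ∃ f : Fin (q + 1) → MvPolynomial (Fin (q + 1)) ℂ,
          (∀ j, MvPolynomial.IsWeightedHomogeneous d (f j) (d j)) ∧
          (∀ j, G j = MvPolynomial.aeval F (f j)) ∧
          (∀ j, ∀ g : MvPolynomial (Fin (q + 1)) ℂ, G j = MvPolynomial.aeval F g → g = f j) ∧
          f ∈ weightedGL d]) ∧
    Set.BijOn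
      (fun (f : Fin (q + 1) → MvPolynomial (Fin (q + 1)) ℂ) (j : Fin (q + 1)) =>
        (MvPolynomial.aeval F (f j) : PolyRing r))
      (weightedGL d)
      {G | (∀ j, (G j).IsHomogeneous (d j)) ∧
        ∃ c : ℂ, c ≠ 0 ∧ contractEuler (wedgeD G) = c • contractEuler (wedgeD F)} := by
  have hd := degree_ne_zero_of_wedgeD_ne_zero hF hdF
  have hdsum : ∑ j, d j ≠ 0 := fun h => hd 0 (Finset.sum_eq_zero_iff.1 h 0 (Finset.mem_univ 0))
  have hinj := aeval_injective_of_wedgeD_ne_zero hdF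
  have hcontract : ∀ (G : Fin (q + 1) → PolyRing r) (c : ℂ), wedgeD G = c • wedgeD F →
      contractEuler (wedgeD G) = c • contractEuler (wedgeD F) := by
    intro G c h
    rw [h, contractEuler, LinearMap.map_smul_of_tower]
    rfl
  -- The surjectivity in the second part uses the equivalences of the first.
  refine (fun {P Q : Prop} (hP : P) (hQ : P → Q) => And.intro hP (hQ hP)) ?_ ?_
  · intro G hG hdG
    tfae_have 1 → 2 := by
      rintro ⟨c, hc, h⟩
      exact ⟨c, hc, wedgeD_eq_smul_of_contractEuler hF hG hdsum h⟩
    tfae_have 2 → 1 := by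
      rintro ⟨c, hc, h⟩
      exact ⟨c, hc, hcontract G c h⟩
    -- Homogeneous coefficients can be extracted from arbitrary ones.
    have hcoeff : (∀ j, ∃ a, (fun i => MvPolynomial.pderiv i (G j)) =
        Matrix.vecMul a (jacobian F)) →
        ∃ A : Fin (q + 1) → Fin (q + 1) → PolyRing r,
          (∀ j k, IsHomogeneousInt (A j k) ((d j : ℤ) - (d k : ℤ))) ∧
          ∀ j, KaehlerDifferential.D ℂ (PolyRing r) (G j) =
            ∑ k, A j k • KaehlerDifferential.D ℂ (PolyRing r) (F k) := by
      intro h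
      choose a ha using h
      choose A h1 h2 h3 using fun j =>
        exists_isHomogeneous_coeff hF hd (hd j) (hG j) (ha j)
      exact ⟨A, fun j k => isHomogeneousInt_sub_of_isHomogeneous (h1 j k) (h2 j k),
        fun j => (D_eq_sum_smul_D_iff F (G j) (A j)).2 (h3 j)⟩
    tfae_have 2 → 3 := by
      rintro ⟨c, hc, h⟩
      refine hcoeff fun j => ?_
      refine exists_eq_vecMul_of_minors (jacobian F) ((wedgeD_ne_zero_iff F).1 hdF)
        (exists_not_dvd_jacobianMinor hsing) _ fun I => ?_
      have hminors : ∀ I, ((jacobian G).submatrix id I).det =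
          MvPolynomial.C c * ((jacobian F).submatrix id I).det := by
        intro I
        have := (wedgeD_eq_smul_iff F G c).1 h I
        rwa [MvPolynomial.smul_eq_C_mul] at this
      have hrow := det_smul_eq_mul_of_minors (jacobian F) (jacobian G) (MvPolynomial.C c)
        (by simpa using hc) hminors I
      exact ⟨_, congrFun hrow j⟩
    tfae_have 3 → 4 := by
      rintro ⟨A, -, hA⟩
      choose f hf using fun j => exists_eq_aeval_of_gradient hF hdF hsing (d j) (G j) (hG j)
        ⟨A j, (D_eq_sum_smul_D_iff F (G j) (A j)).1 (hA j)⟩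
      exact ⟨f, hf⟩
    tfae_have 4 → 3 := by
      rintro ⟨f, hf⟩
      exact hcoeff fun j => ⟨_, by rw [hf j]; exact gradient_aeval F (f j)⟩
    tfae_have 3 → 2 := by
      rintro ⟨A, hA, h⟩
      obtain ⟨c, hc⟩ := det_eq_C_of_isHomogeneousInt (Matrix.of A) hA
      have hw := wedgeD_eq_det_smul (Matrix.of A) (Matrix.ext fun j i =>
        congrFun ((D_eq_sum_smul_D_iff F (G j) (A j)).1 (h j)) i) hc
      refine ⟨c, ?_, hw⟩
      rintro rfl
      exact hdG (by rw [hw, zero_smul])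
    tfae_have 5 → 4 := by
      rintro ⟨f, -, hf, -⟩
      exact ⟨f, hf⟩
    tfae_have 4 → 5 := by
      rintro ⟨f, hf⟩
      have hf' : ∀ j, G j =
          MvPolynomial.aeval F (MvPolynomial.weightedHomogeneousComponent d (d j) (f j)) := by
        intro j
        rw [aeval_weightedHomogeneousComponent hF, ← hf,
          MvPolynomial.homogeneousComponent_eq_self (hG j)]
      have hhom : ∀ j, MvPolynomial.IsWeightedHomogeneous d
          (MvPolynomial.weightedHomogeneousComponent d (d j) (f j)) (d j) := fun j =>
        MvPolynomial.weightedHomogeneousComponent_isWeightedHomogeneous _ _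
      refine ⟨_, hhom, hf', fun j g hg => hinj (hg.symm.trans (hf' j)), hhom, ?_⟩
      rw [Matrix.isUnit_iff_isUnit_det, isUnit_iff_ne_zero]
      intro h0
      have := wedgeD_aeval hF hdF _ fun j => hf' j ▸ hG j
      rw [h0, zero_smul] at this
      exact hdG ((congrArg wedgeD (funext hf')).trans this)
    tfae_finish
  intro htfae
  refine ⟨?_, ?_, ?_⟩
  · rintro f ⟨hf, hunit⟩
    have hG : ∀ j, (MvPolynomial.aeval F (f j) : PolyRing r).IsHomogeneous (d j) :=
      fun j => isHomogeneous_aeval hF (hf j)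
    rw [Matrix.isUnit_iff_isUnit_det, isUnit_iff_ne_zero] at hunit
    exact ⟨hG, _, hunit, hcontract _ _ (wedgeD_aeval hF hdF f hG)⟩
  · intro f _ g _ h
    exact funext fun j => hinj (congrFun h j)
  · rintro G ⟨hG, c, hc, h⟩
    have hdG : wedgeD G ≠ 0 := by
      rw [wedgeD_eq_smul_of_contractEuler hF hG hdsum h]
      exact smul_ne_zero hc hdF
    have hiff := (htfae G hG hdG).out 0 4
    obtain ⟨f, -, hf, -, hGL⟩ := hiff.1 ⟨c, hc, h⟩
    exact ⟨f, hGL, funext fun j => (hf j).symm⟩
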